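/- All distributions $F$ below are probability distributions with unbounded support contained in $[0,\infty)$, with tail $\overline F=1-F$, and all limits, limsups and liminfs without a specified variable, as well as the relations $\sim$ (ratio tends to $1$) and $O$, are for $x\to\infty$. Write $F^{*2}=F*F$. * $\mathcal J$: the $F$ such that for every $n\ge 2$, $\lim_{K\to\infty}\liminf_{x\to\infty}\mathbb P(X_{n,1}>x-K\mid S_n>x)=1$, where $X_1,\dots,X_n$ are i.i.d. with distribution $F$, $X_{n,1}=\max_i X_i$ and $S_n=\sum_{i=1}^n X_i$. $\mathcal J_f$: the $F\in\mathcal J$ with finite mean. * $\mathcal K$ (heavy-tailed): $\int_0^\infty e^{\lambda y}F(dy)=\infty$ for all $\lambda>0$; $\mathcal K^c$ is its complement. * $\mathcal S$: $\overline{F^{*2}}(x)\sim 2\overline F(x)$. * $\mathcal D$: $\overline F(tx)=O(\overline F(x))$ for all $t\in(0,1)$. * $\mathcal S(\beta)$, $\beta>0$: $\overline F(x+t)\sim e^{-\beta t}\overline F(x)$ for all real $t\ne0$, $\int_0^\infty e^{\beta y}F(dy)<\infty$, and $\overline{F^{*2}}(x)\sim 2\int_0^\infty e^{\beta y}F(dy)\,\overline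 F(x)$. * $\mathcal{OS}^*$: the mean of $F$ is positive and finite and $\limsup \int_0^x\overline F(x-y)\overline F(y)\,dy\,/\,\overline F(x)<\infty$. Fix $\gamma>0$, and for a distribution $F$ let $G$ be the distribution with $\overline G(x)=1$ for $x<0$ and $\overline G(x)=\overline F(x)e^{-\gamma x}$ for $x\ge 0$. **Proposition 1.4.** There exists a distribution $F\in(\mathcal J_f\cap\mathcal K)\setminus(\mathcal S\cup\mathcal D)$ such that $G\in\mathcal J$. Moreover, every $F\in(\mathcal J_f\cap\mathcal K)\setminus(\mathcal S\cup\mathcal D)$ with $G\in\mathcal J$ satisfies $F\in\mathcal{OS}^*$ and $G\in(\mathcal J\cap\mathcal K^c)\setminus\bigcup_{\beta>0}\mathcal S(\beta)$. -/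

import Mathlib

open MeasureTheory ProbabilityTheory Filter Topology Asymptotics Set
open scoped ENNReal

noncomputable section

namespace BigJump

/-- A distribution with unbounded support contained in `[0, ∞)`. -/
structure Dist where
  /-- the underlying law on the real line -/
  law : Measure ℝ
  isProb : IsProbabilityMeasure law
  support_nonneg : law (Iio 0) = 0
  support_unbounded : ∀ x : ℝ, 0 < law (Ioi x)

attribute [instance] Dist.isProb

namespace Dist

/-- The tail `x ↦ F((x, ∞)) = 1 - F(x)`. -/
def tail (F : Dist) (x : ℝ) : ℝ := F.law.real (Ioi x)

/-- The tail of the two-fold convolution of `F` with itself. -/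
def convTail (F : Dist) (x : ℝ) : ℝ := (F.law ∗ F.law).real (Ioi x)

/-- The mean `∫ y F(dy)` over `[0, ∞)`, possibly infinite. -/
def mean (F : Dist) : ℝ≥0∞ := ∫⁻ y in Ici 0, ENNReal.ofReal y ∂F.law

/-- The exponential moment `∫ e^{r y} F(dy)` over `[0, ∞)`, possibly infinite. -/
def expMoment (F : Dist) (r : ℝ) : ℝ≥0∞ :=
  ∫⁻ y in Ici 0, ENNReal.ofReal (Real.exp (r * y)) ∂F.law

/-- `P(X_{n,1} > x - K ∣ S_n > x)`, where `X_1, …, X_n` are independent with law `F` (realised as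
the coordinates of the product space), `X_{n,1}` is the largest of them and `S_n` is their sum. -/
def jumpProb (F : Dist) (n : ℕ) (K x : ℝ) : ℝ≥0∞ :=
  ProbabilityTheory.cond (Measure.pi fun _ : Fin n => F.law)
    {ω | x < ∑ i, ω i} {ω | x - K < ⨆ i, ω i}

/-- The limsup of `(∫_0^x F̄(x - y) F̄(y) dy) / F̄(x)` as `x → ∞`, possibly infinite. -/
def cOtimes (F : Dist) : ℝ≥0∞ :=
  limsup (fun x : ℝ =>
    ENNReal.ofReal ((∫ y in (0 : ℝ)..x, F.tail (x - y) * F.tail y) / F.tail x)) atTop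

lemma tail_pos (F : Dist) (x : ℝ) : 0 < F.tail x :=
  ENNReal.toReal_pos (F.support_unbounded x).ne' (measure_ne_top _ _)

lemma tail_le_one (F : Dist) (x : ℝ) : F.tail x ≤ 1 := measureReal_le_one

lemma tail_antitone (F : Dist) : Antitone F.tail := fun _ _ h =>
  measureReal_mono (Ioi_subset_Ioi h)

lemma tail_eq (F : Dist) (x : ℝ) : F.tail x = 1 - cdf F.law x := by
  rw [cdf_eq_real, ← probReal_compl_eq_one_sub measurableSet_Iic, compl_Iic, tail]

/-- The tail of the transform of `F`: `1` for `x < 0` and `F̄(x) e^{-γ x}` for `x ≥ 0`. -/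
def transformTail (F : Dist) (γ x : ℝ) : ℝ :=
  if x < 0 then 1 else F.tail x * Real.exp (-γ * x)

lemma transformTail_antitone (F : Dist) {γ : ℝ} (hγ : 0 < γ) : Antitone (F.transformTail γ) := by
  intro x y h
  unfold transformTail
  have key : ∀ z : ℝ, 0 ≤ z → Real.exp (-γ * z) ≤ 1 := fun z hz =>
    Real.exp_le_one_iff.2 (by nlinarith)
  split_ifs with h1 h2 h2
  · exact le_rfl
  · linarith
  · exact mul_le_one₀ (F.tail_le_one y) (Real.exp_pos _).le (key y (not_lt.1 h1))
  · exact mul_le_mul (F.tail_antitone h) (Real.exp_le_exp.2 (by nlinarith)) (Real.exp_pos _).le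
      (F.tail_pos x).le

/-- The distribution function of the transform of `F`. -/
def transformCDF (F : Dist) (γ : ℝ) (hγ : 0 < γ) : StieltjesFunction ℝ where
  toFun x := 1 - F.transformTail γ x
  mono' x y h := sub_le_sub_left (F.transformTail_antitone hγ h) 1
  right_continuous' x := by
    refine continuousWithinAt_const.sub ?_
    by_cases hx : x < 0
    · have : F.transformTail γ =ᶠ[𝓝 x] fun _ => (1 : ℝ) := by
        filter_upwards [Iio_mem_nhds hx] with y hy
        exact if_pos hy
      exact (continuousAt_const.congr this.symm).continuousWithinAt
    · have h1 : ContinuousWithinAt (fun y => F.tail y * Real.exp (-γ * y)) (Ici x) x := by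
        simp_rw [tail_eq]
        exact (continuousWithinAt_const.sub ((cdf F.law).right_continuous x)).mul
          (by fun_prop)
      exact h1.congr (fun y hy => if_neg (not_lt.2 ((not_lt.1 hx).trans hy))) (if_neg hx)

lemma transformTail_tendsto_atTop (F : Dist) {γ : ℝ} (hγ : 0 < γ) :
    Tendsto (F.transformTail γ) atTop (𝓝 0) := by
  have h : Tendsto (fun x : ℝ => Real.exp (-γ * x)) atTop (𝓝 0) :=
    Real.tendsto_exp_atBot.comp (tendsto_id.const_mul_atTop_of_neg (by linarith))
  refine tendsto_of_tendsto_of_tendsto_of_le_of_le' tendsto_const_nhds h ?_ ?_ <;>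
    filter_upwards [eventually_ge_atTop 0] with x hx <;>
    rw [transformTail, if_neg (not_lt.2 hx)]
  · exact mul_nonneg (F.tail_pos x).le (Real.exp_pos _).le
  · exact mul_le_of_le_one_left (Real.exp_pos _).le (F.tail_le_one x)

lemma transformCDF_tendsto_atTop (F : Dist) (γ : ℝ) (hγ : 0 < γ) :
    Tendsto (F.transformCDF γ hγ) atTop (𝓝 1) := by
  have h := (tendsto_const_nhds (x := (1 : ℝ))).sub (F.transformTail_tendsto_atTop hγ)
  rw [sub_zero] at h
  exact h

lemma transformCDF_of_neg (F : Dist) (γ : ℝ) (hγ : 0 < γ) {x : ℝ} (hx : x < 0) :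
    F.transformCDF γ hγ x = 0 := by
  change 1 - F.transformTail γ x = 0
  rw [transformTail, if_pos hx, sub_self]

lemma transformCDF_tendsto_atBot (F : Dist) (γ : ℝ) (hγ : 0 < γ) :
    Tendsto (F.transformCDF γ hγ) atBot (𝓝 0) := by
  refine tendsto_const_nhds.congr' ?_
  filter_upwards [eventually_lt_atBot 0] with x hx
  exact (F.transformCDF_of_neg γ hγ hx).symm

lemma transformCDF_measure_Ioi (F : Dist) (γ : ℝ) (hγ : 0 < γ) (x : ℝ) :
    (F.transformCDF γ hγ).measure (Ioi x) = ENNReal.ofReal (F.transformTail γ x) := by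
  rw [StieltjesFunction.measure_Ioi _ (F.transformCDF_tendsto_atTop γ hγ)]
  congr 1
  exact sub_sub_cancel _ _

lemma transformTail_pos (F : Dist) (γ x : ℝ) : 0 < F.transformTail γ x := by
  unfold transformTail
  split_ifs
  · exact one_pos
  · exact mul_pos (F.tail_pos x) (Real.exp_pos _)

/-- The distribution `G` with `Ḡ(x) = 1` for `x < 0` and `Ḡ(x) = F̄(x) e^{-γ x}` for `x ≥ 0`. -/
def transform (F : Dist) (γ : ℝ) (hγ : 0 < γ) : Dist where
  law := (F.transformCDF γ hγ).measure
  isProb := StieltjesFunction.isProbabilityMeasure _ (F.transformCDF_tendsto_atBot γ hγ)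
    (F.transformCDF_tendsto_atTop γ hγ)
  support_nonneg := by
    rw [StieltjesFunction.measure_Iio _ (F.transformCDF_tendsto_atBot γ hγ), sub_zero,
      ENNReal.ofReal_eq_zero]
    refine ((F.transformCDF γ hγ).mono.tendsto_leftLim 0 |>.congr' ?_ |> fun h =>
      (tendsto_nhds_unique h tendsto_const_nhds).le)
    filter_upwards [self_mem_nhdsWithin] with x hx
    exact F.transformCDF_of_neg γ hγ hx
  support_unbounded x := by
    rw [transformCDF_measure_Ioi]
    exact ENNReal.ofReal_pos.2 (F.transformTail_pos γ x)

/-- The transform has the prescribed tail. -/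
lemma transform_tail (F : Dist) (γ : ℝ) (hγ : 0 < γ) (x : ℝ) :
    (F.transform γ hγ).tail x = if x < 0 then 1 else F.tail x * Real.exp (-γ * x) := by
  change ((F.transformCDF γ hγ).measure (Ioi x)).toReal = _
  rw [transformCDF_measure_Ioi, ENNReal.toReal_ofReal (F.transformTail_pos γ x).le, transformTail]

end Dist

/-- The class `𝒥`: the principle of a single big jump. -/
def classJ : Set Dist :=
  {F | ∀ n : ℕ, 2 ≤ n →
    Tendsto (fun K : ℝ => liminf (fun x : ℝ => F.jumpProb n K x) atTop) atTop (𝓝 1)}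

/-- The class `𝒥_f`: members of `𝒥` with finite mean. -/
def classJf : Set Dist := {F | F ∈ classJ ∧ F.mean < ∞}

/-- The class `𝒦` of heavy-tailed distributions. Its complement is the light-tailed class. -/
def classK : Set Dist := {F | ∀ r : ℝ, 0 < r → F.expMoment r = ∞}

/-- The class `𝒮` of subexponential distributions. -/
def classS : Set Dist := {F | F.convTail ~[atTop] fun x => 2 * F.tail x}

/-- The class `𝒟` of dominatedly varying distributions. -/
def classD : Set Dist :=
  {F | ∀ t : ℝ, t ∈ Ioo 0 1 → (fun x => F.tail (t * x)) =O[atTop] F.tail}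

/-- The exponential class `ℒ(β)`. -/
def classLexp (β : ℝ) : Set Dist :=
  {F | ∀ t : ℝ, t ≠ 0 →
    (fun x => F.tail (x + t)) ~[atTop] fun x => Real.exp (-β * t) * F.tail x}

/-- The convolution equivalent class `𝒮(β)`. -/
def classSexp (β : ℝ) : Set Dist :=
  {F | F ∈ classLexp β ∧ F.expMoment β < ∞ ∧
    F.convTail ~[atTop] fun x => 2 * (F.expMoment β).toReal * F.tail x}

/-- The generalized strongly subexponential class `𝒪𝒮*`. -/
def classOSstar : Set Dist := {F | 0 < F.mean ∧ F.mean < ∞ ∧ F.cOtimes < ∞}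

end BigJump

end

open BigJump

noncomputable section

namespace BigJump
namespace Dist

/-! Existence rests on a tilting-invariant criterion for `classJ` (`mem_classJ_of_tail_mul_le`):
unit shifts cost the tail at most a constant factor, and F̄(y)F̄(z) ≤ (b(y)+b(z))F̄(y+z) with b
decreasing and summable over the integers. Since e^{-γy}e^{-γz} = e^{-γ(y+z)}, the second condition
passes to G with the same b, so one estimate puts both F and G in 𝒥. The example is the law of ⌈E⌉²
for E standard exponential, with tail exp(-⌊√x⌋). It is heavy-tailed with finite mean, its drop by a
factor e at each square rules out 𝒮, and F̄(m²)/F̄(4m²) = e^m rules out 𝒟.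

For the second claim, G ∈ 𝒥 makes the convolution tail of G of order Ḡ. Each unit interval starting
at an integer k carries at least the fraction 1-e^{-γ} of Ḡ(k), so ∫Ḡ(x-y)Ḡ(y)dy is also O(Ḡ(x));
the common factor e^{-γx} cancels and gives 𝒪𝒮* for F. If G were in ℒ(β), the ratios F̄(x+t)/F̄(x)
would tend to e^{(γ-β)t}. Heavy tails force β = γ, so F is long-tailed, and a long-tailed member of
𝒥 is subexponential (`mem_classS_of_mem_classJ`), a contradiction. -/

/-! ### Two-fold convolution tails and what membership in 𝒥 says about them. -/

lemma convTail_eq (F : Dist) (x : ℝ) :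
    F.convTail x = (F.law.prod F.law).real {p | x < p.1 + p.2} := by
  rw [convTail, Measure.conv, map_measureReal_apply (by fun_prop) measurableSet_Ioi]
  rfl

lemma lawReal_Iic (F : Dist) (x : ℝ) : F.law.real (Iic x) = 1 - F.tail x := by
  rw [tail, ← compl_Iic, probReal_compl_eq_one_sub measurableSet_Iic]
  ring

lemma tail_mul_tail_le_convTail (F : Dist) (x M : ℝ) :
    F.tail (x - M) * F.tail M ≤ F.convTail x := by
  rw [convTail_eq, tail, tail, ← measureReal_prod_prod]
  refine measureReal_mono ?_
  rintro ⟨a, b⟩ ⟨ha, hb⟩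
  simp only [mem_Ioi, mem_ofPred_eq] at *
  linarith

/-- When both summands are at least a, a sum at most x forces each to be at most x - a, and 1-(1-t)²
= t(2-t). Taking a = 0 gives the lower half of subexponentiality; taking a > 0 refutes it for the
example. -/
lemma le_convTail_of_law_Iio_eq_zero (F : Dist) {a : ℝ} (ha : F.law (Iio a) = 0) (x : ℝ) :
    F.tail (x - a) * (2 - F.tail (x - a)) ≤ F.convTail x := by
  have hm : MeasurableSet {p : ℝ × ℝ | x < p.1 + p.2} :=
    measurableSet_lt (by fun_prop) (by fun_prop)
  have h1 : (F.law.prod F.law).real {p | x < p.1 + p.2}ᶜ ≤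
      (F.law.prod F.law).real (Iic (x - a) ×ˢ Iic (x - a)) := by
    have h0 : ∀ᵐ y ∂F.law, a ≤ y := by
      rw [ae_iff]
      simp only [not_le]
      exact ha
    have h2 : ∀ᵐ p ∂F.law.prod F.law, a ≤ p.1 := Measure.quasiMeasurePreserving_fst.ae h0
    have h3 : ∀ᵐ p ∂F.law.prod F.law, a ≤ p.2 := Measure.quasiMeasurePreserving_snd.ae h0
    refine ENNReal.toReal_mono (measure_ne_top _ _) (measure_mono_ae ?_)
    filter_upwards [h2, h3] with p hp1 hp2 hp
    have hp' : ¬ x < p.1 + p.2 := hp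
    have : p ∈ Iic (x - a) ×ˢ Iic (x - a) := by
      constructor <;> simp only [mem_Iic] <;> linarith
    exact this
  rw [measureReal_prod_prod, lawReal_Iic, probReal_compl_eq_one_sub hm, ← convTail_eq] at h1
  nlinarith

lemma pi_exists_lt_le (F : Dist) (n : ℕ) (t : ℝ) :
    (Measure.pi fun _ : Fin n => F.law).real {ω | ∃ i, t < ω i} ≤ n * F.tail t := by
  have h : {ω : Fin n → ℝ | ∃ i, t < ω i} = ⋃ i ∈ Finset.univ, {ω | t < ω i} := by
    ext; simp
  rw [h]
  refine (measureReal_biUnion_finset_le _ _).trans ?_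
  have hi : ∀ i : Fin n,
      (Measure.pi fun _ : Fin n => F.law).real {ω | t < ω i} = F.tail t := fun i =>
    (measurePreserving_eval (fun _ : Fin n => F.law) i).measureReal_preimage
      measurableSet_Ioi.nullMeasurableSet
  simp [hi]

lemma measurableSet_lt_sum (n : ℕ) (x : ℝ) : MeasurableSet {ω : Fin n → ℝ | x < ∑ i, ω i} :=
  measurableSet_lt measurable_const (by fun_prop)

lemma setOf_lt_iSup {n : ℕ} [NeZero n] (t : ℝ) :
    {ω : Fin n → ℝ | t < ⨆ i, ω i} = {ω | ∃ i, t < ω i} := by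
  ext ω
  exact lt_ciSup_iff (finite_range ω).bddAbove

lemma pi_two_lt_sum (F : Dist) (x : ℝ) :
    (Measure.pi fun _ : Fin 2 => F.law).real {ω | x < ∑ i, ω i} = F.convTail x := by
  rw [convTail_eq, ← (measurePreserving_finTwoArrow F.law).measureReal_preimage
    (measurableSet_lt (by fun_prop) (by fun_prop)).nullMeasurableSet]
  simp [Fin.sum_univ_two, MeasurableEquiv.finTwoArrow_apply]

/-- The case n = 2 of the definition of 𝒥, combined with the union bound for the maximum. All later
uses of the hypothesis of being in 𝒥 go through this. -/
lemma convTail_le_of_mem_classJ {F : Dist} (hF : F ∈ classJ) {δ : ℝ} (hδ : 0 ≤ δ) (hδ1 : δ < 1) :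
    ∃ K : ℝ, 0 < K ∧ ∀ᶠ x in atTop, δ * F.convTail x ≤ 2 * F.tail (x - K) := by
  have h1 : ENNReal.ofReal δ < 1 := by
    rw [← ENNReal.ofReal_one]
    exact (ENNReal.ofReal_lt_ofReal_iff one_pos).2 hδ1
  obtain ⟨K, hK, hK0⟩ := (((hF 2 le_rfl).eventually_const_lt h1).and (eventually_gt_atTop 0)).exists
  refine ⟨K, hK0, ?_⟩
  filter_upwards [eventually_lt_of_lt_liminf hK] with x hx
  set μ := Measure.pi fun _ : Fin 2 => F.law
  rw [jumpProb, cond_apply (measurableSet_lt_sum 2 x), setOf_lt_iSup] at hx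
  have hpos : 0 < μ.real {ω | x < ∑ i, ω i} := by
    rw [pi_two_lt_sum]
    exact (mul_pos (F.tail_pos (x - 0)) (F.tail_pos 0)).trans_le (F.tail_mul_tail_le_convTail x 0)
  have h2 := (ENNReal.toReal_mono (ENNReal.mul_ne_top (ENNReal.inv_ne_top.2 ?_)
    (measure_ne_top _ _)) hx.le)
  · rw [ENNReal.toReal_ofReal hδ, ENNReal.toReal_mul, ENNReal.toReal_inv] at h2
    have h3 : μ.real ({ω | x < ∑ i, ω i} ∩ {ω | ∃ i, x - K < ω i}) ≤ 2 * F.tail (x - K) :=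
      (measureReal_mono inter_subset_right).trans (by exact_mod_cast F.pi_exists_lt_le 2 (x - K))
    rw [← pi_two_lt_sum]
    refine le_trans ?_ h3
    change δ ≤ (μ.real _)⁻¹ * μ.real _ at h2
    rwa [← div_eq_inv_mul, le_div_iff₀ hpos] at h2
  · intro h
    rw [measureReal_def, h] at hpos
    simp at hpos

/-- At level x + K, one summand above x - M and the other above K + M already give a large sum,
while the convolution tail there is at most 4F̄(x). -/
lemma tail_sub_le_of_mem_classJ {F : Dist} (hF : F ∈ classJ) (M : ℝ) :
    ∃ C : ℝ, ∀ᶠ x in atTop, F.tail (x - M) ≤ C * F.tail x := by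
  obtain ⟨K, -, hK⟩ := convTail_le_of_mem_classJ hF (δ := 1 / 2) (by norm_num) (by norm_num)
  refine ⟨4 / F.tail (K + M), ?_⟩
  filter_upwards [(tendsto_atTop_add_const_right atTop K tendsto_id).eventually hK] with x hx
  have h := F.tail_mul_tail_le_convTail (x + K) (K + M)
  simp only [id, add_sub_cancel_right] at hx
  rw [show x + K - (K + M) = x - M by ring] at h
  rw [div_mul_eq_mul_div, le_div_iff₀ (F.tail_pos _)]
  linarith

lemma convTail_le_mul_tail_of_mem_classJ {F : Dist} (hF : F ∈ classJ) :
    ∃ C : ℝ, ∀ᶠ x in atTop, F.convTail x ≤ C * F.tail x := by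
  obtain ⟨K, -, hK⟩ := convTail_le_of_mem_classJ hF (δ := 1 / 2) (by norm_num) (by norm_num)
  obtain ⟨C, hC⟩ := tail_sub_le_of_mem_classJ hF K
  refine ⟨4 * C, ?_⟩
  filter_upwards [hK, hC] with x h1 h2
  linarith

/-- A long-tailed member of `𝒥` is subexponential. -/
lemma mem_classS_of_mem_classJ {F : Dist} (hF : F ∈ classJ)
    (hL : ∀ t : ℝ, 0 < t → Tendsto (fun x => F.tail (x - t) / F.tail x) atTop (𝓝 1))
    (h0 : Tendsto F.tail atTop (𝓝 0)) : F ∈ classS := by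
  refine (isEquivalent_iff_tendsto_one (Eventually.of_forall fun x =>
    (mul_pos two_pos (F.tail_pos x)).ne')).2 ?_
  rw [tendsto_order]
  constructor
  · intro a ha
    have : Tendsto (fun x => 1 - F.tail x / 2) atTop (𝓝 1) := by
      simpa using (h0.div_const 2).const_sub 1
    filter_upwards [this.eventually_const_lt ha] with x hx
    refine hx.trans_le ?_
    have h := F.le_convTail_of_law_Iio_eq_zero F.support_nonneg x
    rw [sub_zero] at h
    rw [Pi.div_apply, le_div_iff₀ (mul_pos two_pos (F.tail_pos x))]
    linarith
  · intro a ha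
    -- With 1/a < δ < 1 the slack δa > 1 absorbs the ratio F̄(x-K)/F̄(x), which tends to 1.
    obtain ⟨δ, hδ, hδ1⟩ := exists_between (inv_lt_one_of_one_lt₀ ha)
    have hδ0 : 0 < δ := (inv_pos.2 (one_pos.trans ha)).trans hδ
    obtain ⟨K, hK0, hK⟩ := convTail_le_of_mem_classJ hF hδ0.le hδ1
    have h1 : 1 < δ * a := (inv_lt_iff_one_lt_mul₀ (one_pos.trans ha)).1 hδ
    filter_upwards [hK, (hL K hK0).eventually_lt_const h1] with x hx h2
    rw [div_lt_iff₀ (F.tail_pos x)] at h2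
    rw [Pi.div_apply, div_lt_iff₀ (mul_pos two_pos (F.tail_pos x))]
    have : δ * F.convTail x < δ * (a * (2 * F.tail x)) := by linarith
    exact lt_of_mul_lt_mul_left this hδ0.le

lemma tail_tendsto_zero (F : Dist) : Tendsto F.tail atTop (𝓝 0) := by
  have h := (tendsto_cdf_atTop F.law).const_sub 1
  rw [sub_self] at h
  exact h.congr fun x => (F.tail_eq x).symm


/-! ### Exponential moments, means and heavy tails. -/

/-- A geometric bound on the tail along the integers gives a finite exponential moment. -/
lemma exists_expMoment_lt_top (F : Dist) {N : ℕ} {q : ℝ} (hq : q < 1)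
    (h : ∀ k : ℕ, F.tail (N + k) ≤ q ^ k) : ∃ r : ℝ, 0 < r ∧ F.expMoment r < ∞ := by
  have hq0 : 0 < q := by simpa using (F.tail_pos _).trans_le (h 1)
  obtain ⟨r, hr, hrq⟩ : ∃ r : ℝ, 0 < r ∧ Real.exp r * q < 1 := by
    -- This r makes e^r q = √q.
    refine ⟨-Real.log q / 2, by have := Real.log_neg hq0 hq; linarith, ?_⟩
    have h2 : Real.exp (-Real.log q / 2) * q = Real.exp (Real.log q / 2) := by
      nth_rewrite 2 [← Real.exp_log hq0]
      rw [← Real.exp_add]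
      congr 1
      ring
    rw [h2, Real.exp_lt_one_iff]
    have := Real.log_neg hq0 hq
    linarith
  refine ⟨r, hr, ?_⟩
  have hb : ∀ y : ℝ, ENNReal.ofReal (Real.exp (r * y)) ≤ ENNReal.ofReal (Real.exp (r * N)) +
      ∑' k : ℕ, (Ioi ((N : ℝ) + k)).indicator
        (fun _ => ENNReal.ofReal (Real.exp (r * (N + k + 1)))) y := by
    intro y
    by_cases hy : y ≤ N
    · refine le_add_right (ENNReal.ofReal_le_ofReal (Real.exp_le_exp.2 ?_))
      exact mul_le_mul_of_nonneg_left hy hr.le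
    · push Not at hy
      refine le_add_left ?_
      have hc : 0 < ⌈y - N⌉₊ := Nat.ceil_pos.2 (by linarith)
      have hk : ((⌈y - N⌉₊ - 1 : ℕ) : ℝ) = (⌈y - N⌉₊ : ℝ) - 1 := by
        rw [Nat.cast_sub hc, Nat.cast_one]
      have h1 := Nat.ceil_lt_add_one (a := y - N) (by linarith)
      have h2 := Nat.le_ceil (y - N)
      refine le_trans ?_ (ENNReal.le_tsum (⌈y - N⌉₊ - 1))
      rw [indicator_of_mem (by rw [mem_Ioi, hk]; linarith)]
      refine ENNReal.ofReal_le_ofReal (Real.exp_le_exp.2 ?_)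
      rw [hk]
      exact mul_le_mul_of_nonneg_left (by linarith) hr.le
  calc F.expMoment r ≤ ∫⁻ y, ENNReal.ofReal (Real.exp (r * y)) ∂F.law :=
        setLIntegral_le_lintegral _ _
    _ ≤ ∫⁻ y, (ENNReal.ofReal (Real.exp (r * N)) + ∑' k : ℕ, (Ioi ((N : ℝ) + k)).indicator
        (fun _ => ENNReal.ofReal (Real.exp (r * (N + k + 1)))) y) ∂F.law := lintegral_mono hb
    _ = ENNReal.ofReal (Real.exp (r * N)) +
        ∑' k : ℕ, ENNReal.ofReal (Real.exp (r * (N + k + 1))) * F.law (Ioi (N + k)) := by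
      rw [lintegral_add_left measurable_const, lintegral_const, measure_univ, mul_one,
        lintegral_tsum fun k => (measurable_const.indicator measurableSet_Ioi).aemeasurable]
      congr 1
      refine tsum_congr fun k => ?_
      rw [lintegral_indicator_const measurableSet_Ioi]
    _ ≤ ENNReal.ofReal (Real.exp (r * N)) +
        ∑' k : ℕ, ENNReal.ofReal (Real.exp (r * (N + 1)) * (Real.exp r * q) ^ k) := by
      gcongr with k
      rw [← ofReal_measureReal, ← ENNReal.ofReal_mul (Real.exp_pos _).le]
      refine ENNReal.ofReal_le_ofReal ?_
      refine (mul_le_mul_of_nonneg_left (h k) (Real.exp_pos _).le).trans_eq ?_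
      rw [mul_pow, ← Real.exp_nat_mul, ← mul_assoc, ← Real.exp_add]
      congr 2
      ring
    _ < ∞ := by
      refine ENNReal.add_lt_top.2 ⟨ENNReal.ofReal_lt_top, ?_⟩
      have hs : Summable fun k : ℕ => Real.exp (r * (N + 1)) * (Real.exp r * q) ^ k :=
        (summable_geometric_of_lt_one (by positivity) hrq).mul_left _
      exact hs.tsum_ofReal_lt_top

/-- For y ≥ 0, y is at most ⌈y⌉, the number of naturals k < y; integrating this count gives the sum
of the tails. -/
lemma mean_lt_top (F : Dist) {b : ℕ → ℝ} (hb : Summable b) (h : ∀ k : ℕ, F.tail k ≤ b k) :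
    F.mean < ∞ := by
  have hy : ∀ y : ℝ, ENNReal.ofReal y ≤ ∑' k : ℕ, (Ioi (k : ℝ)).indicator (fun _ => 1) y := by
    intro y
    calc ENNReal.ofReal y ≤ ENNReal.ofReal (⌈y⌉₊ : ℝ) := ENNReal.ofReal_le_ofReal (Nat.le_ceil y)
      _ = ∑ k ∈ Finset.range ⌈y⌉₊, (Ioi (k : ℝ)).indicator (fun _ => (1 : ℝ≥0∞)) y := by
        rw [Finset.sum_congr rfl (g := fun _ => (1 : ℝ≥0∞))]
        · simp
        · intro k hk
          exact indicator_of_mem (Nat.lt_ceil.1 (Finset.mem_range.1 hk)) _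
      _ ≤ _ := ENNReal.sum_le_tsum _
  calc F.mean ≤ ∫⁻ y, ENNReal.ofReal y ∂F.law := setLIntegral_le_lintegral _ _
    _ ≤ ∫⁻ y, ∑' k : ℕ, (Ioi (k : ℝ)).indicator (fun _ => 1) y ∂F.law := lintegral_mono hy
    _ = ∑' k : ℕ, F.law (Ioi k) := by
      rw [lintegral_tsum fun k => (measurable_const.indicator measurableSet_Ioi).aemeasurable]
      refine tsum_congr fun k => ?_
      rw [lintegral_indicator_const measurableSet_Ioi, one_mul]
    _ ≤ ∑' k : ℕ, ENNReal.ofReal (b k) := by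
      gcongr with k
      rw [← ofReal_measureReal]
      exact ENNReal.ofReal_le_ofReal (h k)
    _ < ∞ := hb.tsum_ofReal_lt_top

lemma mean_pos (F : Dist) : 0 < F.mean := by
  calc (0 : ℝ≥0∞) < F.law (Ioi 1) := F.support_unbounded 1
    _ = ∫⁻ _ in Ioi 1, 1 ∂F.law := by simp
    _ ≤ ∫⁻ y in Ioi 1, ENNReal.ofReal y ∂F.law := by
      refine setLIntegral_mono (by fun_prop) fun y hy => ?_
      rw [← ENNReal.ofReal_one]
      exact ENNReal.ofReal_le_ofReal (mem_Ioi.1 hy).le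
    _ ≤ F.mean := lintegral_mono_set fun y hy => zero_le_one.trans (mem_Ioi.1 hy).le

lemma ofReal_exp_mul_tail_le_expMoment (F : Dist) {r x : ℝ} (hr : 0 < r) (hx : 0 ≤ x) :
    ENNReal.ofReal (Real.exp (r * x) * F.tail x) ≤ F.expMoment r := by
  calc ENNReal.ofReal (Real.exp (r * x) * F.tail x)
      = ∫⁻ _ in Ioi x, ENNReal.ofReal (Real.exp (r * x)) ∂F.law := by
        rw [setLIntegral_const, ENNReal.ofReal_mul (Real.exp_pos _).le, tail, ofReal_measureReal]
    _ ≤ ∫⁻ y in Ioi x, ENNReal.ofReal (Real.exp (r * y)) ∂F.law := by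
      refine setLIntegral_mono (by fun_prop) fun y hy => ?_
      refine ENNReal.ofReal_le_ofReal (Real.exp_le_exp.2 ?_)
      exact mul_le_mul_of_nonneg_left (mem_Ioi.1 hy).le hr.le
    _ ≤ F.expMoment r := lintegral_mono_set fun y hy => hx.trans (mem_Ioi.1 hy).le

lemma transform_tail_of_nonneg (F : Dist) {γ : ℝ} (hγ : 0 < γ) {x : ℝ} (hx : 0 ≤ x) :
    (F.transform γ hγ).tail x = F.tail x * Real.exp (-γ * x) := by
  rw [transform_tail, if_neg (not_lt.2 hx)]

lemma transform_mem_compl_classK (F : Dist) {γ : ℝ} (hγ : 0 < γ) :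
    F.transform γ hγ ∈ classKᶜ := by
  obtain ⟨r, hr, h⟩ := (F.transform γ hγ).exists_expMoment_lt_top (N := 0)
    (q := Real.exp (-γ)) (Real.exp_lt_one_iff.2 (by linarith)) (by
      intro k
      rw [transform_tail_of_nonneg _ _ (by positivity), ← Real.exp_nat_mul]
      refine (mul_le_of_le_one_left (Real.exp_pos _).le (F.tail_le_one _)).trans_eq ?_
      congr 1
      push_cast
      ring)
  exact fun hK => h.ne (hK r hr)

/-- If the tail of a heavy-tailed law has an asymptotic ratio along unit steps, it is `1`. -/
lemma eq_one_of_tail_ratio_tendsto {F : Dist} (hK : F ∈ classK) {q : ℝ}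
    (h : Tendsto (fun x => F.tail (x + 1) / F.tail x) atTop (𝓝 q)) : q = 1 := by
  have hle : q ≤ 1 := le_of_tendsto' h fun x =>
    (div_le_one (F.tail_pos x)).2 (F.tail_antitone (by linarith))
  by_contra hne
  obtain ⟨p, hp, hp1⟩ := exists_between (lt_of_le_of_ne hle hne)
  obtain ⟨a, ha⟩ := eventually_atTop.1 (h.eventually_lt_const hp)
  have hN := Nat.le_ceil a
  set N := ⌈a⌉₊
  have hstep : ∀ x : ℝ, a ≤ x → F.tail (x + 1) ≤ p * F.tail x := fun x hx =>
    ((div_lt_iff₀ (F.tail_pos x)).1 (ha x hx)).le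
  have hp0 : 0 < p := (div_pos (F.tail_pos _) (F.tail_pos a)).trans (ha a le_rfl)
  obtain ⟨r, hr, hr'⟩ := F.exists_expMoment_lt_top (N := N) hp1 (by
    intro k
    induction k with
    | zero => simpa using F.tail_le_one N
    | succ k ih =>
      have h1 := hstep (N + k) (by have : (0 : ℝ) ≤ k := k.cast_nonneg; linarith)
      push_cast
      rw [← add_assoc, pow_succ']
      exact h1.trans (mul_le_mul_of_nonneg_left ih hp0.le))
  exact hr'.ne (hK r hr)


/-! ### The convolution integral of the tail and 𝒪𝒮*. -/

/-- The rectangles {X > x-k, k < Y ≤ k+1} are disjoint and lie in {X + Y > x}. -/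
lemma sum_tail_mul_Ioc_le_convTail (F : Dist) (x : ℝ) (N : ℕ) :
    ∑ k ∈ Finset.range N, F.tail (x - k) * (F.tail k - F.tail (k + 1)) ≤ F.convTail x := by
  have hIoc : ∀ k : ℕ, F.tail k - F.tail (k + 1) = F.law.real (Ioc (k : ℝ) (k + 1)) := by
    intro k
    rw [← Ioi_sdiff_Ioi, measureReal_sdiff (Ioi_subset_Ioi (by linarith)) measurableSet_Ioi]
    rfl
  have hterm : ∀ k : ℕ, F.tail (x - k) * (F.tail k - F.tail (k + 1)) =
      (F.law.prod F.law).real (Ioi (x - k) ×ˢ Ioc (k : ℝ) (k + 1)) := by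
    intro k
    rw [measureReal_prod_prod, hIoc]
    rfl
  rw [Finset.sum_congr rfl fun k _ => hterm k, ← measureReal_biUnion_finset, convTail_eq]
  · refine measureReal_mono ?_
    intro p hp
    simp only [mem_iUnion, mem_prod, mem_Ioi, mem_Ioc] at hp
    obtain ⟨k, -, h1, h2, -⟩ := hp
    change x < p.1 + p.2
    linarith
  · intro i _ j _ hij
    rw [Function.onFun, Set.disjoint_left]
    rintro p ⟨-, hi1, hi2⟩ ⟨-, hj1, hj2⟩
    have h1 : (i : ℝ) < j + 1 := hi1.trans_le hj2
    have h2 : (j : ℝ) < i + 1 := hj1.trans_le hi2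
    norm_cast at h1 h2
    omega
  · exact fun k _ => measurableSet_Ioi.prod measurableSet_Ioc

lemma intervalIntegrable_tail_mul_tail (F : Dist) (x a b : ℝ) :
    IntervalIntegrable (fun y => F.tail (x - y) * F.tail y) volume a b := by
  have h1 : Monotone fun y => F.tail (x - y) := fun y z h => F.tail_antitone (by linarith)
  have h2 := F.tail_antitone.intervalIntegrable (a := a) (b := b) (μ := volume)
  rw [intervalIntegrable_iff] at h2 ⊢
  refine h2.bdd_mul (c := 1) h1.measurable.aestronglyMeasurable (Eventually.of_forall fun y => ?_)
  rw [Real.norm_of_nonneg (F.tail_pos _).le]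
  exact F.tail_le_one _

lemma integral_tail_mul_tail_le (F : Dist) {x : ℝ} (hx : 0 ≤ x) :
    ∫ y in (0 : ℝ)..x, F.tail (x - y) * F.tail y ≤
      ∑ k ∈ Finset.range ⌈x⌉₊, F.tail (x - 1 - k) * F.tail k := by
  calc ∫ y in (0 : ℝ)..x, F.tail (x - y) * F.tail y
      ≤ ∫ y in (0 : ℝ)..(⌈x⌉₊ : ℝ), F.tail (x - y) * F.tail y := by
        refine intervalIntegral.integral_mono_interval le_rfl hx (Nat.le_ceil x)
          (Eventually.of_forall fun y => (mul_pos (F.tail_pos _) (F.tail_pos _)).le)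
          (F.intervalIntegrable_tail_mul_tail x 0 _)
    _ = ∑ k ∈ Finset.range ⌈x⌉₊,
        ∫ y in (k : ℝ)..((k + 1 : ℕ) : ℝ), F.tail (x - y) * F.tail y := by
        rw [intervalIntegral.sum_integral_adjacent_intervals (a := fun k : ℕ => (k : ℝ))
          fun k _ => F.intervalIntegrable_tail_mul_tail x _ _, Nat.cast_zero]
    _ ≤ _ := by
        refine Finset.sum_le_sum fun k _ => ?_
        have hk : (k : ℝ) ≤ ((k + 1 : ℕ) : ℝ) := by push_cast; linarith
        refine (intervalIntegral.integral_mono_on hk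
          (F.intervalIntegrable_tail_mul_tail x _ _) intervalIntegrable_const
          (g := fun _ => F.tail (x - 1 - k) * F.tail k) fun y hy => ?_).trans_eq ?_
        · have h2 := hy.2
          push_cast at h2
          exact mul_le_mul (F.tail_antitone (by linarith)) (F.tail_antitone hy.1)
            (F.tail_pos _).le (F.tail_pos _).le
        · rw [intervalIntegral.integral_const]
          simp

/-- This is where tilting matters: Ḡ(k) is at most a constant times the mass of (k, k+1], so sums of
tails can be compared with the convolution. -/
lemma transform_tail_add_one_le (F : Dist) {γ : ℝ} (hγ : 0 < γ) (k : ℕ) :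
    (F.transform γ hγ).tail (k + 1) ≤ Real.exp (-γ) * (F.transform γ hγ).tail k := by
  rw [transform_tail_of_nonneg _ _ (by positivity), transform_tail_of_nonneg _ _ (by positivity),
    show -γ * ((k : ℝ) + 1) = -γ + -γ * k by ring, Real.exp_add]
  have := F.tail_antitone (show (k : ℝ) ≤ k + 1 by linarith)
  have h := mul_le_mul_of_nonneg_right this
    (mul_pos (Real.exp_pos (-γ)) (Real.exp_pos (-γ * k))).le
  linarith

lemma integral_transform_tail_le (F : Dist) {γ : ℝ} (hγ : 0 < γ)
    (hG : F.transform γ hγ ∈ classJ) : ∃ C : ℝ, ∀ᶠ x in atTop,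
      ∫ y in (0 : ℝ)..x, (F.transform γ hγ).tail (x - y) * (F.transform γ hγ).tail y ≤
        C * (F.transform γ hγ).tail x := by
  obtain ⟨C₁, h₁⟩ := convTail_le_mul_tail_of_mem_classJ hG
  obtain ⟨C₂, h₂⟩ := tail_sub_le_of_mem_classJ hG 1
  set G := F.transform γ hγ
  have hq : 0 < 1 - Real.exp (-γ) := sub_pos.2 (Real.exp_lt_one_iff.2 (by linarith))
  -- C₁ pays for the convolution tail at x - 1, C₂ for moving back to x, and the denominator for
  -- replacing tails by masses.
  refine ⟨(max C₁ 0 * C₂) / (1 - Real.exp (-γ)), ?_⟩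
  filter_upwards [(tendsto_atTop_add_const_right atTop (-1 : ℝ) tendsto_id).eventually h₁, h₂,
    eventually_ge_atTop 0] with x hx1 hx2 hx0
  simp only [id, ← sub_eq_add_neg] at hx1
  refine (G.integral_tail_mul_tail_le hx0).trans ?_
  rw [div_mul_eq_mul_div, le_div_iff₀ hq, Finset.sum_mul]
  calc ∑ k ∈ Finset.range ⌈x⌉₊, G.tail (x - 1 - k) * G.tail k * (1 - Real.exp (-γ))
      ≤ ∑ k ∈ Finset.range ⌈x⌉₊, G.tail (x - 1 - k) * (G.tail k - G.tail (k + 1)) := by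
        refine Finset.sum_le_sum fun k _ => ?_
        rw [mul_assoc]
        refine mul_le_mul_of_nonneg_left ?_ (G.tail_pos _).le
        have := F.transform_tail_add_one_le hγ k
        linarith
    _ ≤ G.convTail (x - 1) := G.sum_tail_mul_Ioc_le_convTail _ _
    _ ≤ C₁ * G.tail (x - 1) := hx1
    _ ≤ max C₁ 0 * G.tail (x - 1) :=
        mul_le_mul_of_nonneg_right (le_max_left _ _) (G.tail_pos _).le
    _ ≤ max C₁ 0 * (C₂ * G.tail x) := mul_le_mul_of_nonneg_left hx2 (le_max_right _ _)
    _ = _ := by ring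

lemma integral_transform_tail_eq (F : Dist) {γ : ℝ} (hγ : 0 < γ) {x : ℝ} (hx : 0 ≤ x) :
    ∫ y in (0 : ℝ)..x, (F.transform γ hγ).tail (x - y) * (F.transform γ hγ).tail y =
      (∫ y in (0 : ℝ)..x, F.tail (x - y) * F.tail y) * Real.exp (-γ * x) := by
  rw [← intervalIntegral.integral_mul_const]
  refine intervalIntegral.integral_congr fun y hy => ?_
  rw [uIcc_of_le hx] at hy
  rw [transform_tail_of_nonneg _ _ hy.1, transform_tail_of_nonneg _ _ (sub_nonneg.2 hy.2),
    show -γ * x = -γ * (x - y) + -γ * y by ring, Real.exp_add]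
  ring

lemma mem_classOSstar_of_transform_mem_classJ {F : Dist} {γ : ℝ} (hγ : 0 < γ)
    (hm : F.mean < ∞) (hG : F.transform γ hγ ∈ classJ) : F ∈ classOSstar := by
  refine ⟨F.mean_pos, hm, ?_⟩
  obtain ⟨C, hC⟩ := F.integral_transform_tail_le hγ hG
  refine lt_of_le_of_lt (limsup_le_of_le (a := ENNReal.ofReal C) (by isBoundedDefault) ?_)
    ENNReal.ofReal_lt_top
  filter_upwards [hC, eventually_ge_atTop 0] with x hx hx0
  refine ENNReal.ofReal_le_ofReal ?_
  rw [F.integral_transform_tail_eq hγ hx0, transform_tail_of_nonneg _ _ hx0, ← mul_assoc] at hx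
  rw [div_le_iff₀ (F.tail_pos x)]
  exact le_of_mul_le_mul_right hx (Real.exp_pos _)

/-! ### Excluding the exponential classes. -/

lemma tail_ratio_tendsto_of_transform_mem_classLexp {F : Dist} {γ β : ℝ} (hγ : 0 < γ)
    (hG : F.transform γ hγ ∈ classLexp β) {t : ℝ} (ht : t ≠ 0) :
    Tendsto (fun x => F.tail (x + t) / F.tail x) atTop (𝓝 (Real.exp ((γ - β) * t))) := by
  have h := (isEquivalent_iff_tendsto_one (Eventually.of_forall fun x =>
    (mul_pos (Real.exp_pos (-β * t)) ((F.transform γ hγ).tail_pos x)).ne')).1 (hG t ht)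
  have h' := h.mul_const (Real.exp ((γ - β) * t))
  rw [one_mul] at h'
  refine h'.congr' ?_
  filter_upwards [eventually_ge_atTop 0, eventually_ge_atTop (-t)] with x hx hxt
  rw [Pi.div_apply, transform_tail_of_nonneg _ _ hx, transform_tail_of_nonneg _ _ (by linarith),
    show -γ * (x + t) = -γ * x + -γ * t by ring, show (γ - β) * t = -β * t - -γ * t by ring,
    Real.exp_sub, Real.exp_add]
  have := (F.tail_pos x).ne'
  field_simp

lemma transform_notMem_classLexp {F : Dist} {γ β : ℝ} (hγ : 0 < γ) (hJ : F ∈ classJ)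
    (hK : F ∈ classK) (hS : F ∉ classS) : F.transform γ hγ ∉ classLexp β := by
  intro hG
  have h1 := eq_one_of_tail_ratio_tendsto hK
    (tail_ratio_tendsto_of_transform_mem_classLexp hγ hG one_ne_zero)
  rw [mul_one, Real.exp_eq_one_iff] at h1
  refine hS (mem_classS_of_mem_classJ hJ (fun t ht => ?_) F.tail_tendsto_zero)
  have h2 := tail_ratio_tendsto_of_transform_mem_classLexp hγ hG (neg_ne_zero.2 ht.ne')
  simpa [h1, ← sub_eq_add_neg] using h2


/-! ### A sufficient criterion for 𝒥. -/

lemma tail_sub_nat_le (F : Dist) {C : ℝ} (hC : ∀ x, 0 ≤ x → F.tail x ≤ C * F.tail (x + 1))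
    (K : ℕ) {x : ℝ} (hx : (K : ℝ) ≤ x) : F.tail (x - K) ≤ C ^ K * F.tail x := by
  have hC0 : 0 ≤ C := by
    have := (F.tail_pos 0).trans_le (hC 0 le_rfl)
    exact (pos_of_mul_pos_left this (F.tail_pos _).le).le
  induction K with
  | zero => simp
  | succ K ih =>
    push_cast at hx ⊢
    have h1 := hC (x - (K + 1)) (by linarith)
    rw [show x - ((K : ℝ) + 1) + 1 = x - K by ring] at h1
    refine h1.trans ?_
    rw [pow_succ', mul_assoc]
    exact mul_le_mul_of_nonneg_left (ih (by linarith)) hC0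

lemma tail_le_pi_lt_sum (F : Dist) (n : ℕ) [NeZero n] (x : ℝ) :
    F.tail x ≤ (Measure.pi fun _ : Fin n => F.law).real {ω | x < ∑ i, ω i} := by
  set μ := Measure.pi fun _ : Fin n => F.law
  have h0 : ∀ᵐ y ∂F.law, 0 ≤ y := by
    rw [ae_iff]
    simp only [not_le]
    exact F.support_nonneg
  have h1 : ∀ᵐ ω ∂μ, ∀ i, 0 ≤ ω i := ae_all_iff.2 fun i =>
    (measurePreserving_eval (fun _ : Fin n => F.law) i).quasiMeasurePreserving.ae h0
  have h2 : μ.real {ω | x < ω 0} = F.tail x :=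
    (measurePreserving_eval (fun _ : Fin n => F.law) 0).measureReal_preimage
      measurableSet_Ioi.nullMeasurableSet
  rw [← h2]
  refine ENNReal.toReal_mono (measure_ne_top _ _) (measure_mono_ae ?_)
  filter_upwards [h1] with ω hω h
  exact lt_of_lt_of_le h (Finset.single_le_sum (f := ω) (fun i _ => hω i) (Finset.mem_univ 0))

/-- For large x, either no coordinate is big, which the hypothesis controls, or some coordinate
exceeds x - K, which costs nC^K F̄(x). For small x the tail is bounded below, so the trivial bound 1
suffices. -/
lemma exists_pi_lt_sum_le (F : Dist) {C : ℝ}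
    (hC : ∀ x, 0 ≤ x → F.tail x ≤ C * F.tail (x + 1)) {n K : ℕ}
    (hK : ∀ᶠ x in atTop, (Measure.pi fun _ : Fin n => F.law).real
      {ω | x < ∑ i, ω i ∧ ∀ i, ω i ≤ x - K} ≤ 1 * F.tail x) :
    ∃ D : ℝ, 0 ≤ D ∧ ∀ x, (Measure.pi fun _ : Fin n => F.law).real {ω | x < ∑ i, ω i} ≤
      D * F.tail x := by
  set μ := Measure.pi fun _ : Fin n => F.law
  obtain ⟨a, ha⟩ := eventually_atTop.1 (hK.and (eventually_ge_atTop (K : ℝ)))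
  refine ⟨max (1 / F.tail a) (1 + n * C ^ K), le_max_of_le_left (by have := F.tail_pos a; positivity),
    fun x => ?_⟩
  rcases le_total a x with hx | hx
  · obtain ⟨h1, h2⟩ := ha x hx
    have h3 : μ.real {ω | x < ∑ i, ω i} ≤ μ.real {ω | x < ∑ i, ω i ∧ ∀ i, ω i ≤ x - K} +
        μ.real {ω | ∃ i, x - K < ω i} := by
      refine (measureReal_mono fun ω hω => ?_).trans (measureReal_union_le _ _)
      by_cases h : ∀ i, ω i ≤ x - K
      · exact Or.inl ⟨hω, h⟩
      · push Not at h
        exact Or.inr h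
    have h4 := F.pi_exists_lt_le n (x - K)
    have h5 := mul_le_mul_of_nonneg_left (F.tail_sub_nat_le hC K h2) (Nat.cast_nonneg (α := ℝ) n)
    calc μ.real {ω | x < ∑ i, ω i} ≤ (1 + n * C ^ K) * F.tail x := by linarith
      _ ≤ _ := mul_le_mul_of_nonneg_right (le_max_right _ _) (F.tail_pos x).le
  · calc μ.real {ω | x < ∑ i, ω i} ≤ 1 := measureReal_le_one
      _ ≤ 1 / F.tail a * F.tail x := by
        rw [div_mul_eq_mul_div, one_mul, one_le_div (F.tail_pos a)]
        exact F.tail_antitone hx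
      _ ≤ _ := mul_le_mul_of_nonneg_right (le_max_left _ _) (F.tail_pos x).le

lemma exists_sum_Ico_le {b : ℕ → ℝ} (hb : Summable b) {ε : ℝ} (hε : 0 < ε) :
    ∃ N : ℕ, ∀ m n, N ≤ m → ∑ k ∈ Finset.Ico m n, b k ≤ ε := by
  obtain ⟨s, hs⟩ := summable_iff_vanishing_norm.1 hb ε hε
  obtain ⟨N, hN⟩ := s.exists_nat_subset_range
  refine ⟨N, fun m n hm => (le_abs_self _).trans (hs _ ?_).le⟩
  rw [Finset.disjoint_left]
  intro k hk hks
  have h1 := (Finset.mem_Ico.1 hk).1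
  have h2 := Finset.mem_range.1 (hN hks)
  omega

/-- Induction step: let a be the first coordinate and y the sum of the others. If y > x - K', the
others themselves have a large sum without a big jump. Otherwise a ≤ x - K keeps y away from 0, and
slicing by k < y ≤ k+1 gives a > x-k-1, with k at distance about K' from both ends. -/
lemma pi_succ_real_le (F : Dist) (n : ℕ) (x : ℝ) {K K' K₁ : ℕ}
    (hK : K₁ + K' + 1 ≤ K) :
    (Measure.pi fun _ : Fin (n + 1) => F.law).real {ω | x < ∑ i, ω i ∧ ∀ i, ω i ≤ x - K} ≤
      (Measure.pi fun _ : Fin n => F.law).real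
        {ω | x - K' < ∑ i, ω i ∧ ∀ i, ω i ≤ x - K' - K₁} +
      ∑ k ∈ Finset.Ico K' (⌊x⌋₊ + 1 - K'), F.tail (x - k - 1) *
        (Measure.pi fun _ : Fin n => F.law).real {ω | (k : ℝ) < ∑ i, ω i} := by
  set μ := Measure.pi fun _ : Fin n => F.law
  have hK2 : (K₁ : ℝ) + K' + 1 ≤ K := by exact_mod_cast hK
  have hK3 : (0 : ℝ) ≤ K₁ := K₁.cast_nonneg
  have hmp := measurePreserving_piFinSuccAbove (fun _ : Fin (n + 1) => F.law) 0
  have hpre : {ω : Fin (n + 1) → ℝ | x < ∑ i, ω i ∧ ∀ i, ω i ≤ x - K} =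
      MeasurableEquiv.piFinSuccAbove (fun _ : Fin (n + 1) => ℝ) 0 ⁻¹'
        {p | x < p.1 + ∑ i, p.2 i ∧ p.1 ≤ x - K ∧ ∀ i, p.2 i ≤ x - K} := by
    ext ω
    simp [Fin.sum_univ_succ, Fin.forall_fin_succ, MeasurableEquiv.piFinSuccAbove_apply,
      Fin.insertNthEquiv, Fin.tail]
  have hprod : ∀ (s : Set ℝ) (t : Set (Fin n → ℝ)),
      (F.law.prod μ).real (s ×ˢ t) = F.law.real s * μ.real t := measureReal_prod_prod
  have hone : ∀ t : Set (Fin n → ℝ), μ.real t = (F.law.prod μ).real (univ ×ˢ t) := by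
    intro t
    rw [hprod, probReal_univ, one_mul]
  rw [hpre, measureReal_def, hmp.measure_preimage_equiv, ← measureReal_def, hone]
  simp only [tail, ← hprod]
  refine le_trans (measureReal_mono ?_) ((measureReal_union_le _ _).trans
    (add_le_add_right (measureReal_biUnion_finset_le _ _) _))
  rintro ⟨a, ω⟩ ⟨h1, h2, h3⟩
  simp only at h1 h2 h3
  set y := ∑ i, ω i
  by_cases hy : x - K' < y
  · exact Or.inl ⟨mem_univ _, hy, fun i => (h3 i).trans (by linarith)⟩
  · push Not at hy
    right
    have hyK : (K' : ℝ) + 1 < y := by linarith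
    have hc : 0 < ⌈y⌉₊ := Nat.ceil_pos.2 (by have : (0 : ℝ) ≤ K' := K'.cast_nonneg; linarith)
    obtain ⟨k, hk⟩ : ∃ k, ⌈y⌉₊ = k + 1 := ⟨⌈y⌉₊ - 1, by omega⟩
    have hky : (k : ℝ) < y := Nat.lt_ceil.1 (by omega)
    have hyk : y ≤ k + 1 := by
      have := Nat.le_ceil y
      rw [hk] at this
      exact_mod_cast this
    have hk1 : K' < k := by
      have : (K' : ℝ) < k := by linarith
      exact_mod_cast this
    have hk2 : k + K' ≤ ⌊x⌋₊ := by
      refine Nat.le_floor ?_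
      push_cast
      linarith
    refine mem_iUnion₂.2 ⟨k, Finset.mem_Ico.2 ⟨hk1.le, by omega⟩, ?_, hky⟩
    simp only [mem_Ioi]
    linarith

/-- Under a summable product bound on the tail, a sum of independent copies is unlikely to
be large without a big jump. -/
lemma exists_pi_no_big_jump_le (F : Dist) {C : ℝ} {b : ℝ → ℝ}
    (hC : ∀ x, 0 ≤ x → F.tail x ≤ C * F.tail (x + 1)) (hb : Antitone b)
    (hs : Summable fun k : ℕ => b k)
    (hF : ∀ y z, 0 ≤ y → 0 ≤ z → F.tail y * F.tail z ≤ (b y + b z) * F.tail (y + z)) (n : ℕ) :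
    ∀ ε : ℝ, 0 < ε → ∃ K : ℕ, ∀ᶠ x in atTop, (Measure.pi fun _ : Fin n => F.law).real
      {ω | x < ∑ i, ω i ∧ ∀ i, ω i ≤ x - K} ≤ ε * F.tail x := by
  have hC0 : 0 < C := by
    have := (F.tail_pos 0).trans_le (hC 0 le_rfl)
    exact pos_of_mul_pos_left this (F.tail_pos _).le
  induction n with
  | zero =>
    intro ε hε
    refine ⟨0, ?_⟩
    filter_upwards [eventually_ge_atTop 0] with x hx
    have : {ω : Fin 0 → ℝ | x < ∑ i, ω i ∧ ∀ i, ω i ≤ x - (0 : ℕ)} = ∅ := by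
      ext ω
      simp [hx]
    rw [this, measureReal_empty]
    exact (mul_pos hε (F.tail_pos x)).le
  | succ n ih =>
    intro ε hε
    obtain ⟨K₀, hK₀⟩ := ih 1 one_pos
    obtain ⟨D, hD0, hD⟩ := F.exists_pi_lt_sum_le hC hK₀
    -- The slices cost DC times two tail sums of b, so this choice keeps them within ε/2; the +1
    -- guards against DC = 0.
    obtain ⟨N, hN⟩ := exists_sum_Ico_le hs (ε := ε / (4 * (D * C + 1))) (by positivity)
    -- The power of C cancels the cost of shifting the tail by N + 1.
    obtain ⟨K₁, hK₁⟩ := ih (ε / (2 * C ^ (N + 1))) (by positivity)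
    refine ⟨K₁ + (N + 1) + 1, ?_⟩
    have hshift : Tendsto (fun x : ℝ => x - ((N + 1 : ℕ) : ℝ)) atTop atTop :=
      tendsto_atTop_add_const_right _ _ tendsto_id
    filter_upwards [hshift.eventually hK₁, eventually_ge_atTop ((2 * N + 2 : ℕ) : ℝ)] with x hx hxN
    have hx0 : 0 ≤ x := (Nat.cast_nonneg _).trans hxN
    have hM : 2 * N + 2 ≤ ⌊x⌋₊ := Nat.le_floor hxN
    refine (F.pi_succ_real_le n x le_rfl).trans ?_
    set M := ⌊x⌋₊ with hMdef
    have hMx : (M : ℝ) ≤ x := Nat.floor_le hx0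
    have hfirst : ε / (2 * C ^ (N + 1)) * F.tail (x - ((N + 1 : ℕ) : ℝ)) ≤ ε / 2 * F.tail x := by
      have h1 := F.tail_sub_nat_le hC (N + 1) (x := x)
        (le_trans (by exact_mod_cast (by omega : N + 1 ≤ 2 * N + 2)) hxN)
      refine (mul_le_mul_of_nonneg_left h1 (by positivity)).trans_eq ?_
      field_simp
    have hterm : ∀ k ∈ Finset.Ico (N + 1) (M + 1 - (N + 1)),
        F.tail (x - k - 1) * (Measure.pi fun _ : Fin n => F.law).real {ω | (k : ℝ) < ∑ i, ω i} ≤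
          D * C * F.tail x * (b ((M - 1 - k : ℕ) : ℝ) + b k) := by
      intro k hk
      rw [Finset.mem_Ico] at hk
      have hk1 : ((M - 1 - k : ℕ) : ℝ) ≤ x - k - 1 := by
        rw [Nat.sub_sub, Nat.cast_sub (by omega)]
        push_cast
        linarith
      have hk0 : 0 ≤ x - k - 1 := (Nat.cast_nonneg _).trans hk1
      have h1 := hF (x - k - 1) k hk0 k.cast_nonneg
      rw [show x - k - 1 + (k : ℝ) = x - 1 by ring] at h1
      have h2 : b (x - k - 1) + b k ≤ b ((M - 1 - k : ℕ) : ℝ) + b k := by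
        have := hb hk1
        linarith
      have h3 := hC (x - 1) (by have : (0 : ℝ) ≤ k := k.cast_nonneg; linarith)
      rw [sub_add_cancel] at h3
      have h4 : 0 ≤ b ((M - 1 - k : ℕ) : ℝ) + b k := by
        refine le_trans ?_ h2
        have := (mul_pos (F.tail_pos (x - k - 1)) (F.tail_pos k)).le.trans h1
        exact nonneg_of_mul_nonneg_left this (F.tail_pos _)
      calc F.tail (x - k - 1) * (Measure.pi fun _ : Fin n => F.law).real {ω | (k : ℝ) < ∑ i, ω i}
          ≤ F.tail (x - k - 1) * (D * F.tail k) :=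
            mul_le_mul_of_nonneg_left (hD k) (F.tail_pos _).le
        _ = D * (F.tail (x - k - 1) * F.tail k) := by ring
        _ ≤ D * ((b ((M - 1 - k : ℕ) : ℝ) + b k) * (C * F.tail x)) := by
            refine mul_le_mul_of_nonneg_left (h1.trans ?_) hD0
            exact mul_le_mul h2 h3 (F.tail_pos _).le h4
        _ = _ := by ring
    have hsum := Finset.sum_le_sum hterm
    -- The reflection k ↦ M-1-k turns the other family into a tail sum of b as well. It starts at N,
    -- one below the cut-off N + 1.
    rw [← Finset.mul_sum, Finset.sum_add_distrib,
      Finset.sum_Ico_reflect (fun j : ℕ => b j) (N + 1) (by omega)] at hsum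
    have h1 := hN (M - 1 + 1 - (M + 1 - (N + 1))) (M - 1 + 1 - (N + 1)) (by omega)
    have h2 := hN (N + 1) (M + 1 - (N + 1)) (by omega)
    have h3 : D * C * F.tail x * (ε / (4 * (D * C + 1)) + ε / (4 * (D * C + 1))) ≤
        ε / 2 * F.tail x := by
      have h4 : D * C / (D * C + 1) ≤ 1 := (div_le_one (by positivity)).2 (by linarith)
      calc D * C * F.tail x * (ε / (4 * (D * C + 1)) + ε / (4 * (D * C + 1)))
          = ε / 2 * F.tail x * (D * C / (D * C + 1)) := by field_simp; ring
        _ ≤ _ := mul_le_of_le_one_right (mul_pos (half_pos hε) (F.tail_pos x)).le h4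
    have h5 := hsum.trans ((mul_le_mul_of_nonneg_left (add_le_add h1 h2)
      (mul_nonneg (mul_nonneg hD0 hC0.le) (F.tail_pos x).le)).trans h3)
    have h6 := hx.trans hfirst
    linarith

lemma jumpProb_le_one (F : Dist) (n : ℕ) (K x : ℝ) : F.jumpProb n K x ≤ 1 := by
  rw [jumpProb, cond_apply (measurableSet_lt_sum n x)]
  exact (mul_le_mul_right (measure_mono inter_subset_left) _).trans (ENNReal.inv_mul_le_one _)

lemma one_sub_le_jumpProb (F : Dist) (n : ℕ) [NeZero n] {K x ε : ℝ} (hε : 0 ≤ ε)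
    (h : (Measure.pi fun _ : Fin n => F.law).real
      {ω | x < ∑ i, ω i ∧ ∀ i, ω i ≤ x - K} ≤ ε * F.tail x) :
    ENNReal.ofReal (1 - ε) ≤ F.jumpProb n K x := by
  rw [jumpProb, cond_apply (measurableSet_lt_sum n x), setOf_lt_iSup]
  have hA := F.tail_le_pi_lt_sum n x
  set μ := Measure.pi fun _ : Fin n => F.law
  set A := {ω : Fin n → ℝ | x < ∑ i, ω i} with hAdef
  have hApos : 0 < μ.real A := (F.tail_pos x).trans_le hA
  have h1 : μ.real A ≤ μ.real (A ∩ {ω | ∃ i, x - K < ω i}) +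
      μ.real {ω | x < ∑ i, ω i ∧ ∀ i, ω i ≤ x - K} := by
    refine (measureReal_mono fun ω hω => ?_).trans (measureReal_union_le _ _)
    by_cases h : ∀ i, ω i ≤ x - K
    · exact Or.inr ⟨hω, h⟩
    · push Not at h
      exact Or.inl ⟨hω, h⟩
  rw [← ofReal_measureReal (μ := μ) (s := A), ← ofReal_measureReal (μ := μ) (s := A ∩ _),
    ← ENNReal.ofReal_inv_of_pos hApos, ← ENNReal.ofReal_mul (inv_pos.2 hApos).le]
  refine ENNReal.ofReal_le_ofReal ?_
  rw [← div_eq_inv_mul, le_div_iff₀ hApos]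
  have := mul_le_mul_of_nonneg_left hA hε
  linarith

/-- A criterion for membership in `𝒥` which is invariant under exponential tilting. -/
lemma mem_classJ_of_tail_mul_le (F : Dist) {C : ℝ} {b : ℝ → ℝ}
    (hC : ∀ x, 0 ≤ x → F.tail x ≤ C * F.tail (x + 1)) (hb : Antitone b)
    (hs : Summable fun k : ℕ => b k)
    (hF : ∀ y z, 0 ≤ y → 0 ≤ z → F.tail y * F.tail z ≤ (b y + b z) * F.tail (y + z)) :
    F ∈ classJ := by
  intro n hn
  have : NeZero n := ⟨by omega⟩
  rw [tendsto_order]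
  constructor
  · intro a ha
    obtain ⟨δ, hδ0, haδ, hδ1⟩ : ∃ δ : ℝ, 0 ≤ δ ∧ a < ENNReal.ofReal δ ∧ δ < 1 := by
      obtain ⟨c, hac, hc1⟩ := exists_between ha
      refine ⟨c.toReal, ENNReal.toReal_nonneg, ?_, ?_⟩
      · rwa [ENNReal.ofReal_toReal (hc1.trans ENNReal.one_lt_top).ne]
      · rw [← ENNReal.toReal_one]
        exact (ENNReal.toReal_lt_toReal (hc1.trans ENNReal.one_lt_top).ne ENNReal.one_ne_top).2 hc1
    obtain ⟨K₀, hK₀⟩ := F.exists_pi_no_big_jump_le hC hb hs hF n (1 - δ) (by linarith)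
    filter_upwards [eventually_ge_atTop (K₀ : ℝ)] with K hK
    refine haδ.trans_le (le_liminf_of_le (by isBoundedDefault) ?_)
    filter_upwards [hK₀] with x hx
    have h := F.one_sub_le_jumpProb n (K := K) (x := x) (ε := 1 - δ) (by linarith)
      ((measureReal_mono ?_).trans hx)
    · simpa using h
    · exact fun ω hω => ⟨hω.1, fun i => (hω.2 i).trans (by linarith)⟩
  · intro a ha
    refine Eventually.of_forall fun K => lt_of_le_of_lt ?_ ha
    refine (liminf_le_liminf (Eventually.of_forall fun x => F.jumpProb_le_one n K x)).trans_eq ?_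
    exact liminf_const _

/-- Tilting multiplies both sides of the product bound by e^{-γ(y+z)}, so b is unchanged and only C
grows, to Ce^γ. -/
lemma transform_mem_classJ_of_tail_mul_le (F : Dist) {γ : ℝ} (hγ : 0 < γ) {C : ℝ} {b : ℝ → ℝ}
    (hC : ∀ x, 0 ≤ x → F.tail x ≤ C * F.tail (x + 1)) (hb : Antitone b)
    (hs : Summable fun k : ℕ => b k)
    (hF : ∀ y z, 0 ≤ y → 0 ≤ z → F.tail y * F.tail z ≤ (b y + b z) * F.tail (y + z)) :
    F.transform γ hγ ∈ classJ := by
  refine mem_classJ_of_tail_mul_le _ (C := C * Real.exp γ) (fun x hx => ?_) hb hs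
    fun y z hy hz => ?_
  · rw [transform_tail_of_nonneg _ _ hx, transform_tail_of_nonneg _ _ (by linarith)]
    refine (mul_le_mul_of_nonneg_right (hC x hx) (Real.exp_pos _).le).trans_eq ?_
    rw [show -γ * x = γ + -γ * (x + 1) by ring, Real.exp_add]
    ring
  · rw [transform_tail_of_nonneg _ _ hy, transform_tail_of_nonneg _ _ hz,
      transform_tail_of_nonneg _ _ (add_nonneg hy hz), mul_add, Real.exp_add]
    have h := mul_le_mul_of_nonneg_right (hF y z hy hz)
      (mul_pos (Real.exp_pos (-γ * y)) (Real.exp_pos (-γ * z))).le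
    linarith


/-! ### The example ⌈E⌉². -/

lemma expMeasure_one_real_Ioi {x : ℝ} (hx : 0 ≤ x) :
    (expMeasure 1).real (Ioi x) = Real.exp (-x) := by
  have := isProbabilityMeasure_expMeasure one_pos
  rw [← compl_Iic, probReal_compl_eq_one_sub measurableSet_Iic, ← cdf_eq_real,
    cdf_expMeasure_eq one_pos, if_pos hx]
  simp

lemma ceil_sq_preimage_Ioi {x : ℝ} (hx : 0 ≤ x) :
    (fun t : ℝ => (⌈t⌉₊ : ℝ) ^ 2) ⁻¹' Ioi x = Ioi ((⌊√x⌋₊ : ℕ) : ℝ) := by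
  ext t
  rw [mem_preimage, mem_Ioi, mem_Ioi, ← Real.sqrt_lt hx (Nat.cast_nonneg _),
    ← Nat.floor_lt (Real.sqrt_nonneg x), Nat.lt_ceil]

lemma measurable_ceil_sq : Measurable fun t : ℝ => (⌈t⌉₊ : ℝ) ^ 2 := by fun_prop

lemma map_ceil_sq_real_Ioi {x : ℝ} (hx : 0 ≤ x) :
    ((expMeasure 1).map fun t : ℝ => (⌈t⌉₊ : ℝ) ^ 2).real (Ioi x) =
      Real.exp (-(⌊√x⌋₊ : ℕ)) := by
  rw [map_measureReal_apply measurable_ceil_sq measurableSet_Ioi, ceil_sq_preimage_Ioi hx,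
    expMeasure_one_real_Ioi (Nat.cast_nonneg _)]

/-- The law of `⌈E⌉²` for a standard exponential variable `E`. -/
def ceilSq : Dist where
  law := (expMeasure 1).map fun t : ℝ => (⌈t⌉₊ : ℝ) ^ 2
  isProb := by
    have := isProbabilityMeasure_expMeasure one_pos
    exact Measure.isProbabilityMeasure_map measurable_ceil_sq.aemeasurable
  support_nonneg := by
    rw [Measure.map_apply measurable_ceil_sq measurableSet_Iio]
    convert measure_empty (μ := expMeasure 1)
    ext t
    simp only [mem_preimage, mem_Iio, mem_empty_iff_false, iff_false, not_lt]
    positivity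
  support_unbounded x := by
    refine lt_of_lt_of_le ?_ (measure_mono (Ioi_subset_Ioi (le_max_left x 0)))
    refine pos_iff_ne_zero.2 fun h => ?_
    have h1 := map_ceil_sq_real_Ioi (le_max_right x 0)
    rw [measureReal_def, h, ENNReal.toReal_zero] at h1
    exact (Real.exp_pos _).ne h1

lemma ceilSq_tail {x : ℝ} (hx : 0 ≤ x) : ceilSq.tail x = Real.exp (-(⌊√x⌋₊ : ℕ)) :=
  map_ceil_sq_real_Ioi hx

lemma ceilSq_tail_nat_sq (m : ℕ) : ceilSq.tail ((m : ℝ) ^ 2) = Real.exp (-m) := by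
  rw [ceilSq_tail (sq_nonneg _), Real.sqrt_sq m.cast_nonneg, Nat.floor_natCast]

lemma exp_neg_sqrt_le_ceilSq_tail {x : ℝ} (hx : 0 ≤ x) : Real.exp (-√x) ≤ ceilSq.tail x := by
  rw [ceilSq_tail hx]
  exact Real.exp_le_exp.2 (neg_le_neg (Nat.floor_le (Real.sqrt_nonneg x)))

lemma ceilSq_tail_le_exp {x : ℝ} (hx : 0 ≤ x) : ceilSq.tail x ≤ Real.exp (1 - √x) := by
  rw [ceilSq_tail hx]
  have := Nat.lt_floor_add_one (√x)
  exact Real.exp_le_exp.2 (by linarith)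

lemma ceilSq_tail_le_mul_tail_add_one {x : ℝ} (hx : 0 ≤ x) :
    ceilSq.tail x ≤ Real.exp 2 * ceilSq.tail (x + 1) := by
  have h1 : √(x + 1) ≤ √x + 1 := by
    have h2 := Real.sq_sqrt hx
    have h3 := Real.sqrt_nonneg x
    rw [Real.sqrt_le_left (by positivity)]
    nlinarith
  calc ceilSq.tail x ≤ Real.exp (1 - √x) := ceilSq_tail_le_exp hx
    _ ≤ Real.exp (2 + -√(x + 1)) := Real.exp_le_exp.2 (by linarith)
    _ = Real.exp 2 * Real.exp (-√(x + 1)) := Real.exp_add _ _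
    _ ≤ _ := mul_le_mul_of_nonneg_left (exp_neg_sqrt_le_ceilSq_tail (by linarith))
        (Real.exp_pos _).le

/-- Squaring the right side gives z + √y√z + y/4 ≥ z + y. The unused half of √y is the decay in the
smaller variable that yields b. -/
lemma sqrt_add_le_of_le {y z : ℝ} (hy : 0 ≤ y) (hyz : y ≤ z) : √(y + z) ≤ √z + √y / 2 := by
  have h1 := Real.sqrt_le_sqrt hyz
  have h2 := Real.sq_sqrt hy
  have h3 := Real.sq_sqrt (hy.trans hyz)
  have h4 := Real.sqrt_nonneg y
  rw [Real.sqrt_le_left (by positivity)]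
  nlinarith

/-- This function serves as b; the constant 2 pays for the floors in the two tails being multiplied.
-/
lemma antitone_exp_sub_sqrt : Antitone fun t : ℝ => Real.exp (2 - √t / 2) := fun s t h =>
  Real.exp_le_exp.2 (by have := Real.sqrt_le_sqrt h; linarith)

lemma summable_exp_sub_sqrt : Summable fun k : ℕ => Real.exp (2 - √(k : ℝ) / 2) := by
  -- From e^u ≥ u⁴/4! at u = √k/2, with 384 = 2⁴·4!.
  have h : Summable fun k : ℕ => Real.exp 2 * (384 * (1 / (k : ℝ) ^ 2)) :=
    ((Real.summable_one_div_nat_pow.2 one_lt_two).mul_left _).mul_left _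
  refine h.of_norm_bounded_eventually_nat ?_
  filter_upwards [eventually_ge_atTop 1] with k hk
  have hk0 : (0 : ℝ) < k := by exact_mod_cast hk
  rw [Real.norm_of_nonneg (Real.exp_pos _).le, Real.exp_sub, div_eq_mul_inv, ← Real.exp_neg]
  refine mul_le_mul_of_nonneg_left ?_ (Real.exp_pos _).le
  have h1 := Real.pow_div_factorial_le_exp (√(k : ℝ) / 2) (by positivity) 4
  have h2 : (√(k : ℝ) / 2) ^ 4 / (Nat.factorial 4 : ℝ) = (k : ℝ) ^ 2 / 384 := by
    rw [div_pow, show √(k : ℝ) ^ 4 = (√(k : ℝ) ^ 2) ^ 2 by ring, Real.sq_sqrt hk0.le]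
    norm_num [Nat.factorial]
    ring
  rw [h2] at h1
  rw [Real.exp_neg]
  refine (inv_anti₀ (by positivity) h1).trans_eq ?_
  field_simp

lemma ceilSq_tail_mul_le_of_le {y z : ℝ} (hy : 0 ≤ y) (hyz : y ≤ z) :
    ceilSq.tail y * ceilSq.tail z ≤ Real.exp (2 - √y / 2) * ceilSq.tail (y + z) := by
  have hz := hy.trans hyz
  calc ceilSq.tail y * ceilSq.tail z ≤ Real.exp (1 - √y) * Real.exp (1 - √z) :=
        mul_le_mul (ceilSq_tail_le_exp hy) (ceilSq_tail_le_exp hz) (tail_pos _ _).le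
          (Real.exp_pos _).le
    _ ≤ Real.exp (2 - √y / 2) * Real.exp (-√(y + z)) := by
        rw [← Real.exp_add, ← Real.exp_add]
        refine Real.exp_le_exp.2 ?_
        have := sqrt_add_le_of_le hy hyz
        linarith
    _ ≤ _ := mul_le_mul_of_nonneg_left (exp_neg_sqrt_le_ceilSq_tail (by linarith))
        (Real.exp_pos _).le

lemma ceilSq_tail_mul_le {y z : ℝ} (hy : 0 ≤ y) (hz : 0 ≤ z) :
    ceilSq.tail y * ceilSq.tail z ≤
      (Real.exp (2 - √y / 2) + Real.exp (2 - √z / 2)) * ceilSq.tail (y + z) := by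
  have h0 := ceilSq.tail_pos (y + z)
  have h1 := mul_pos (Real.exp_pos (2 - √y / 2)) h0
  have h2 := mul_pos (Real.exp_pos (2 - √z / 2)) h0
  rw [add_mul]
  rcases le_total y z with h | h
  · have := ceilSq_tail_mul_le_of_le hy h
    linarith
  · have := ceilSq_tail_mul_le_of_le hz h
    rw [mul_comm, add_comm z y] at this
    linarith

lemma ceilSq_mem_classJf : ceilSq ∈ classJf := by
  refine ⟨mem_classJ_of_tail_mul_le _ (fun _ => ceilSq_tail_le_mul_tail_add_one)
    antitone_exp_sub_sqrt summable_exp_sub_sqrt fun _ _ => ceilSq_tail_mul_le,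
    mean_lt_top _ summable_exp_sub_sqrt fun k => ?_⟩
  refine (ceilSq_tail_le_exp k.cast_nonneg).trans (Real.exp_le_exp.2 ?_)
  have := Real.sqrt_nonneg (k : ℝ)
  linarith

lemma ceilSq_mem_classK : ceilSq ∈ classK := by
  intro r hr
  by_contra hne
  set M := (ceilSq.expMoment r).toReal
  have hM0 : 0 ≤ M := ENNReal.toReal_nonneg
  have hM : ∀ s : ℝ, 0 ≤ s → Real.exp (r * s ^ 2 - s) ≤ M := by
    intro s hs
    have h1 := ENNReal.toReal_mono hne
      (ceilSq.ofReal_exp_mul_tail_le_expMoment hr (sq_nonneg s))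
    rw [ENNReal.toReal_ofReal (mul_pos (Real.exp_pos _) (tail_pos _ _)).le] at h1
    refine le_trans ?_ h1
    have h2 := exp_neg_sqrt_le_ceilSq_tail (sq_nonneg s)
    rw [Real.sqrt_sq hs] at h2
    rw [sub_eq_add_neg, Real.exp_add]
    exact mul_le_mul_of_nonneg_left h2 (Real.exp_pos _).le
  -- Then s(rs - 1) ≥ M, so the exponential is at least M + 1, contradicting the bound M.
  set s := max 1 ((M + 1) / r)
  have hs1 : 1 ≤ s := le_max_left _ _
  have hs2 : M + 1 ≤ s * r := (div_le_iff₀ hr).1 (le_max_right _ _)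
  have h1 := hM s (by linarith)
  have h2 := Real.add_one_le_exp (r * s ^ 2 - s)
  nlinarith

lemma tendsto_nat_sq : Tendsto (fun m : ℕ => (m : ℝ) ^ 2) atTop atTop :=
  (tendsto_pow_atTop two_ne_zero).comp tendsto_natCast_atTop_atTop

/-- Just below a square the tail t is at least e times its value at the square. As both summands
exceed 1/2, the convolution tail at m² is at least t(2-t) ≥ (7/4)t once t < 1/4, hence more than
3F̄(m²), whereas membership in 𝒮 would make it eventually smaller than that. -/
lemma ceilSq_notMem_classS : ceilSq ∉ classS := by
  intro h
  have h1 := (isEquivalent_iff_tendsto_one (Eventually.of_forall fun x =>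
    (mul_pos two_pos (ceilSq.tail_pos x)).ne')).1 h
  have h2 := (h1.comp tendsto_nat_sq).eventually_lt_const (show (1 : ℝ) < 3 / 2 by norm_num)
  have hshift : Tendsto (fun m : ℕ => (m : ℝ) ^ 2 - 1 / 2) atTop atTop :=
    tendsto_atTop_add_const_right _ _ tendsto_nat_sq
  have h3 := (ceilSq.tail_tendsto_zero.comp hshift).eventually_lt_const
    (show (0 : ℝ) < 1 / 4 by norm_num)
  obtain ⟨m, hm2, hm3, hm⟩ := (h2.and (h3.and (eventually_ge_atTop 1))).exists
  have hm' : (1 : ℝ) ≤ m := by exact_mod_cast hm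
  simp only [Function.comp_apply, Pi.div_apply] at hm2 hm3
  rw [div_lt_iff₀ (mul_pos two_pos (tail_pos _ _))] at hm2
  have h0 : ceilSq.law (Iio (1 / 2)) = 0 := by
    have hfl : ⌊√(1 / 2 : ℝ)⌋₊ = 0 := by
      rw [Nat.floor_eq_zero, Real.sqrt_lt' one_pos]
      norm_num
    have h5 := ceilSq.lawReal_Iic (1 / 2)
    rw [ceilSq_tail (by norm_num), hfl, Nat.cast_zero, neg_zero, Real.exp_zero, sub_self,
      measureReal_eq_zero_iff] at h5
    exact measure_mono_null Iio_subset_Iic_self h5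
  have h6 := ceilSq.le_convTail_of_law_Iio_eq_zero h0 ((m : ℝ) ^ 2)
  have h7 : Real.exp 1 * ceilSq.tail ((m : ℝ) ^ 2) ≤ ceilSq.tail ((m : ℝ) ^ 2 - 1 / 2) := by
    rw [ceilSq_tail_nat_sq, ← Real.exp_add, ceilSq_tail (by nlinarith)]
    refine Real.exp_le_exp.2 ?_
    have h8 : ⌊√((m : ℝ) ^ 2 - 1 / 2)⌋₊ < m := by
      rw [Nat.floor_lt (Real.sqrt_nonneg _), Real.sqrt_lt' (by linarith)]
      linarith
    have h9 : ((⌊√((m : ℝ) ^ 2 - 1 / 2)⌋₊ : ℕ) : ℝ) + 1 ≤ m := by exact_mod_cast h8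
    linarith
  have h8 := ceilSq.tail_pos ((m : ℝ) ^ 2)
  have h9 := ceilSq.tail_pos ((m : ℝ) ^ 2 - 1 / 2)
  have h10 := mul_lt_mul_of_pos_right Real.exp_one_gt_two h8
  nlinarith

lemma ceilSq_notMem_classD : ceilSq ∉ classD := by
  intro h
  -- Scaling by 1/4 maps (2m)² to m², where the tail ratio is exactly e^m.
  obtain ⟨c, hc⟩ := (h (1 / 4) (by norm_num)).bound
  have h1 : Tendsto (fun m : ℕ => ((2 * m : ℕ) : ℝ) ^ 2) atTop atTop :=
    tendsto_nat_sq.comp (tendsto_id.const_mul_atTop' two_pos)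
  obtain ⟨m, hm, hmc⟩ := ((h1.eventually hc).and
    (tendsto_natCast_atTop_atTop.eventually_ge_atTop c)).exists
  rw [show 1 / 4 * ((2 * m : ℕ) : ℝ) ^ 2 = (m : ℝ) ^ 2 by push_cast; ring, ceilSq_tail_nat_sq,
    ceilSq_tail_nat_sq, Real.norm_of_nonneg (Real.exp_pos _).le,
    Real.norm_of_nonneg (Real.exp_pos _).le] at hm
  have h2 : Real.exp (-(m : ℝ)) = Real.exp m * Real.exp (-((2 * m : ℕ) : ℝ)) := by
    rw [← Real.exp_add]
    congr 1
    push_cast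
    ring
  rw [h2] at hm
  have h3 := le_of_mul_le_mul_right hm (Real.exp_pos _)
  have h4 := Real.add_one_le_exp (m : ℝ)
  linarith

end Dist
end BigJump

end

theorem proposition1p4 (γ : ℝ) (hγ : 0 < γ) :
    (∃ F : Dist, F ∈ (classJf ∩ classK) \ (classS ∪ classD) ∧ F.transform γ hγ ∈ classJ) ∧
    (∀ F : Dist, F ∈ (classJf ∩ classK) \ (classS ∪ classD) → F.transform γ hγ ∈ classJ →
      F ∈ classOSstar ∧
      F.transform γ hγ ∈ (classJ ∩ classKᶜ) \ ⋃ β ∈ Ioi (0 : ℝ), classSexp β) := by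
  refine ⟨⟨Dist.ceilSq, ⟨⟨Dist.ceilSq_mem_classJf, Dist.ceilSq_mem_classK⟩, ?_⟩, ?_⟩, ?_⟩
  · rintro (h | h)
    · exact Dist.ceilSq_notMem_classS h
    · exact Dist.ceilSq_notMem_classD h
  · exact Dist.transform_mem_classJ_of_tail_mul_le _ hγ
      (fun _ => Dist.ceilSq_tail_le_mul_tail_add_one) Dist.antitone_exp_sub_sqrt
      Dist.summable_exp_sub_sqrt fun _ _ => Dist.ceilSq_tail_mul_le
  · rintro F ⟨⟨⟨hJ, hm⟩, hK⟩, hSD⟩ hG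
    refine ⟨Dist.mem_classOSstar_of_transform_mem_classJ hγ hm hG,
      ⟨hG, F.transform_mem_compl_classK hγ⟩, fun h => ?_⟩
    obtain ⟨β, -, hβ⟩ := mem_iUnion₂.1 h
    exact Dist.transform_notMem_classLexp hγ hJ hK (fun hS => hSD (Or.inl hS)) hβ.1
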